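/- Let $\mathcal H$ be a reproducing kernel Hilbert space of real functions on a measurable space $\mathcal X$ with measurable reproducing kernel $h$ and feature map $\psi(x)=h(x,\cdot)$, and assume that $0\le h(x,y)\le B$ for all $x,y\in\mathcal X$. For a probability measure $P$ on $\mathcal X$ let $\mu_h(P)=\mathbb E_{X\sim P}[\psi(X)]\in\mathcal H$ be its kernel mean embedding, that is, the element with $\langle \mu_h(P),f\rangle_{\mathcal H}=\mathbb E_{X\sim P}[f(X)]$ for all $f\in\mathcal H$. For $K\ge 2$ and sample sizes $n_1,\ldots,n_K\ge 1$ put $N=\sum_k n_k$, $n_{\min}=\min_k n_k$, $n_{\max}=\max_k n_k$, $r_N^\star=\sqrt{\log K/n_{\min}}$, and for $\epsilon\in\mathbb R$ $$\mathcal F_h(\epsilon)=\Big\{(P_1,\ldots,P_K)\ \text{probability measures on } \mathcal X:\ \max_{1\le k<l\le K}\|\mu_h(P_k)-\mu_h(P_l)\|_{\mathcal H}\ge\epsilon\Big\}.$$ Let $X_{1,k},\ldots,X_{n_k,k}\sim P_k$, $k=1,\ldots,K$, be mutually independent, and let $Z_1,\ldots,Z_N$ be the pooled sample. Let $$\widehat{\mathcal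 V}_{h,\max}=\max_{1\le k<l\le K}\Big\|\frac1{n_k}\sum_{i=1}^{n_k}\psi(X_{i,k})-\frac1{n_l}\sum_{j=1}^{n_l}\psi(X_{j,l})\Big\|_{\mathcal H},$$ and for a permutation $\boldsymbol b$ of $\{1,\ldots,N\}$ let $\widehat{\mathcal V}^{(\boldsymbol b)}_{h,\max}$ be the same statistic computed from $Z_{b_1},\ldots,Z_{b_N}$. Let $\boldsymbol b_1',\ldots,\boldsymbol b_M'$ be permutations drawn uniformly with replacement from all $N!$ permutations, independently of the data, and let $$p_{\mathrm{MC}}=\frac1{M+1}\Big\{1+\sum_{i=1}^M\mathbf 1\big(\widehat{\mathcal V}^{(\boldsymbol b_i')}_{h,\max}\ge\widehat{\mathcal V}_{h,\max}\big)\Big\},\qquad \phi_{K,\mathrm{MC}}=\mathbf 1(p_{\mathrm{MC}}\le\alpha),$$ where $0<\alpha<1$ is fixed. Suppose that $n_{\min}\to\infty$, where $K\ge2$ may be fixed or may vary with the sample sizes, that $n_{\max}/n_{\min}\le c$ for a fixed constant $c>0$, and that $b_N$ is an arbitrary sequence that goes to infinity as $n_{\min}\to\infty$. Then $$\lim_{M\to\infty}\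 \limsup_{n_{\min}\to\infty}\ \sup_{(P_1,\ldots,P_K)\in\mathcal F_h(b_Nr_N^\star)}\mathbb P\big(\phi_{K,\mathrm{MC}}=0\big)=0.$$ -/

import Mathlib

open MeasureTheory ProbabilityTheory Filter Topology
open scoped ENNReal RealInnerProductSpace

namespace KSampleMMD

noncomputable section

section Kernel

variable {𝒳 : Type*} (H : Type*) [NormedAddCommGroup H] [InnerProductSpace ℝ H] [CompleteSpace H]
  [RKHS ℝ H 𝒳 ℝ]

/-- The canonical feature map `ψ x = h(x, ·)` of a reproducing kernel Hilbert space `H` of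
real-valued functions on `𝒳`. -/
def featureMap (x : 𝒳) : H := RKHS.kerFun H x (1 : ℝ)

/-- The (real-valued) reproducing kernel `h` of `H`. -/
def rkernel (x y : 𝒳) : ℝ := RKHS.kernel H x y (1 : ℝ)

variable {H} in
theorem inner_featureMap_left (x : 𝒳) (f : H) : ⟪featureMap H x, f⟫ = f x := by
  simp [featureMap]

theorem inner_featureMap (x y : 𝒳) : ⟪featureMap H x, featureMap H y⟫ = rkernel H x y := by
  rw [inner_featureMap_left, featureMap, RKHS.kerFun_apply, rkernel]

theorem featureMap_apply (x y : 𝒳) : featureMap H y x = rkernel H x y := by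
  rw [← inner_featureMap, inner_featureMap_left]

variable [MeasurableSpace 𝒳]

variable {H} in
/-- `m` is the kernel mean embedding of `P`: the element of `H` that represents the
expectation under `P`, i.e. `E_{X ∼ P} f(X) = ⟨m, f⟩` for all `f` in `H`. -/
def IsMeanEmbedding (P : Measure 𝒳) (m : H) : Prop :=
  ∀ f : H, Integrable (fun x => f x) P ∧ ⟪m, f⟫ = ∫ x, f x ∂P

open scoped Classical in
/-- The kernel mean embedding `μ_h(P) = E_{X ∼ P} h(X, ·)` (zero if it does not exist). -/
def meanEmbedding (P : Measure 𝒳) : H :=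
  if hP : ∃ m : H, IsMeanEmbedding P m then hP.choose else 0

/-- The maximum mean discrepancy `‖μ_h(P) - μ_h(Q)‖_H`. -/
def mmd (P Q : Measure 𝒳) : ℝ := ‖meanEmbedding H P - meanEmbedding H Q‖

variable {H} in
/-- The mean embedding is uniquely determined. -/
theorem IsMeanEmbedding.unique {P : Measure 𝒳} {m m' : H} (h : IsMeanEmbedding P m)
    (h' : IsMeanEmbedding P m') : m = m' :=
  ext_inner_right ℝ fun f => by rw [(h f).2, (h' f).2]

variable {H} in
theorem IsMeanEmbedding.meanEmbedding_eq {P : Measure 𝒳} {m : H} (h : IsMeanEmbedding P m) :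
    meanEmbedding H P = m := by
  have hP : ∃ m : H, IsMeanEmbedding P m := ⟨m, h⟩
  rw [meanEmbedding, dif_pos hP]
  exact hP.choose_spec.unique h

variable {H} in
/-- The mean embedding is the function `y ↦ E_{X ∼ P} h(X, y)`. -/
theorem IsMeanEmbedding.apply {P : Measure 𝒳} {m : H} (h : IsMeanEmbedding P m) (y : 𝒳) :
    m y = ∫ x, rkernel H x y ∂P := by
  rw [← inner_featureMap_left, real_inner_comm, (h _).2]
  simp_rw [featureMap_apply]

/-- If the feature map is Bochner integrable, then the mean embedding is `E_{X ∼ P} ψ(X)`. -/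
theorem isMeanEmbedding_integral {P : Measure 𝒳} (h : Integrable (featureMap H) P) :
    IsMeanEmbedding P (∫ x, featureMap H x ∂P) := by
  intro f
  have e : ∀ x, f x = ⟪f, featureMap H x⟫ := fun x => by
    rw [real_inner_comm, inner_featureMap_left]
  simp_rw [e]
  exact ⟨h.const_inner f, by rw [real_inner_comm, integral_inner h]⟩

/-- With a measurable kernel, all functions in `H` are measurable. -/
theorem measurable_coe (hm : Measurable fun p : 𝒳 × 𝒳 => rkernel H p.1 p.2) (f : H) :
    Measurable (fun x => f x) := by
  have hf : f ∈ closure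
      (Submodule.span ℝ {RKHS.kerFun H x v | (x : 𝒳) (v : ℝ)} : Set H) := by
    rw [← Submodule.topologicalClosure_coe, RKHS.kerFun_dense]
    exact Submodule.mem_top
  obtain ⟨u, hu, hlim⟩ := mem_closure_iff_seq_limit.1 hf
  have hu' : ∀ k, Measurable (fun x => u k x) := by
    intro k
    refine Submodule.span_induction (p := fun g _ => Measurable fun x => g x)
      ?_ ?_ ?_ ?_ (hu k)
    · rintro _ ⟨y, v, rfl⟩
      have e : ∀ x, RKHS.kerFun H y v x = v * rkernel H x y := by
        intro x
        rw [RKHS.kerFun_apply, rkernel]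
        conv_lhs => rw [← mul_one v, ← smul_eq_mul, map_smul, smul_eq_mul]
      simp_rw [e]
      exact (hm.comp (measurable_id.prodMk measurable_const)).const_mul v
    · simp
    · intro a b _ _ ha hb
      simp only [RKHS.coe_add, Pi.add_apply]
      exact Measurable.add ha hb
    · intro r a _ ha
      simpa using ha.const_mul r
  refine measurable_of_tendsto_metrizable hu' (tendsto_pi_nhds.2 fun x => ?_)
  exact ((RKHS.continuous_eval x).tendsto f).comp hlim

/-- With a bounded measurable kernel, every probability measure has a mean embedding. -/
theorem isMeanEmbedding_meanEmbedding (hm : Measurable fun p : 𝒳 × 𝒳 => rkernel H p.1 p.2)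
    {B : ℝ} (hB : ∀ x y : 𝒳, rkernel H x y ≤ B) (P : Measure 𝒳) [IsProbabilityMeasure P] :
    IsMeanEmbedding P (meanEmbedding H P) := by
  have hbd : ∀ (f : H) (x : 𝒳), ‖f x‖ ≤ √B * ‖f‖ := by
    intro f x
    rw [← inner_featureMap_left]
    refine (norm_inner_le_norm _ _).trans ?_
    gcongr
    refine Real.le_sqrt_of_sq_le ?_
    rw [← real_inner_self_eq_norm_sq, inner_featureMap]
    exact hB x x
  have hint : ∀ f : H, Integrable (fun x => f x) P := fun f =>
    Integrable.of_bound (measurable_coe H hm f).aestronglyMeasurable _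
      (Eventually.of_forall (hbd f))
  let L : H →ₗ[ℝ] ℝ :=
    { toFun := fun f => ∫ x, f x ∂P
      map_add' := fun f g => by simpa using integral_add (hint f) (hint g)
      map_smul' := fun r f => by simpa using integral_const_mul r (fun x => f x) }
  let L' : H →L[ℝ] ℝ := L.mkContinuous (√B) fun f => by
    have h1 := norm_integral_le_of_norm_le_const (μ := P) (Eventually.of_forall (hbd f))
    rw [probReal_univ, mul_one] at h1
    exact h1
  have key : IsMeanEmbedding P ((InnerProductSpace.toDual ℝ H).symm L') := fun f =>
    ⟨hint f, by rw [InnerProductSpace.toDual_symm_apply]; rfl⟩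
  rw [key.meanEmbedding_eq]
  exact key

end Kernel

section Statistic

/-- Labels of the pooled sample: `⟨k, i⟩` is the `i`-th observation of the `k`-th sample, so
that there are `N = n 0 + ⋯ + n (K - 1)` labels. -/
abbrev PooledIndex {K : ℕ} (n : Fin K → ℕ) : Type := Σ k : Fin K, Fin (n k)

/-- The smallest sample size. -/
def nMin {K : ℕ} (n : Fin K → ℕ) : ℕ := ⨅ k, n k

/-- The largest sample size. -/
def nMax {K : ℕ} (n : Fin K → ℕ) : ℕ := ⨆ k, n k

/-- The rate `√(log K / n_min)`. -/
def rStar {K : ℕ} (n : Fin K → ℕ) : ℝ := √(Real.log K / nMin n)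

variable {𝒳 : Type*} (H : Type*) [NormedAddCommGroup H] [InnerProductSpace ℝ H] [CompleteSpace H]
  [RKHS ℝ H 𝒳 ℝ]

/-- The test statistic of the pooled sample `Z`: the maximum over `k < l` of the
distances in `H` between the empirical mean embeddings of the `k`-th and `l`-th samples. -/
def statMax {K : ℕ} (n : Fin K → ℕ) (Z : PooledIndex n → 𝒳) : ℝ :=
  ⨆ p : {p : Fin K × Fin K // p.1 < p.2},
    ‖(n p.1.1 : ℝ)⁻¹ • ∑ i : Fin (n p.1.1), featureMap H (Z ⟨p.1.1, i⟩) -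
      (n p.1.2 : ℝ)⁻¹ • ∑ j : Fin (n p.1.2), featureMap H (Z ⟨p.1.2, j⟩)‖

open scoped Classical in
/-- The Monte-Carlo permutation p-value of the pooled sample `Z` with permutations
`b 0, …, b (M - 1)` of the labels. -/
def pMC {K : ℕ} (n : Fin K → ℕ) (M : ℕ) (Z : PooledIndex n → 𝒳)
    (b : Fin M → Equiv.Perm (PooledIndex n)) : ℝ :=
  1 / ((M : ℝ) + 1) *
    (1 + ∑ i : Fin M, if statMax H n Z ≤ statMax H n (fun s => Z (b i s)) then (1 : ℝ) else 0)

open scoped Classical in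
/-- The test function `1(p_MC ≤ α)`. -/
def testMC {K : ℕ} (n : Fin K → ℕ) (M : ℕ) (α : ℝ) (Z : PooledIndex n → 𝒳)
    (b : Fin M → Equiv.Perm (PooledIndex n)) : ℕ :=
  if pMC H n M Z b ≤ α then 1 else 0

/-- The finite set of permutations carries the discrete σ-algebra. -/
instance instMeasurableSpacePerm {K : ℕ} (n : Fin K → ℕ) :
    MeasurableSpace (Equiv.Perm (PooledIndex n)) := ⊤

variable [MeasurableSpace 𝒳]

/-- The joint law of the data and of the `M` random permutations: the observations are mutually
independent, those of the `k`-th sample have law `P k`, and the permutations are drawn uniformly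
with replacement, independently of the data. -/
def jointLaw {K : ℕ} (n : Fin K → ℕ) (M : ℕ) (P : Fin K → ProbabilityMeasure 𝒳) :
    Measure ((PooledIndex n → 𝒳) × (Fin M → Equiv.Perm (PooledIndex n))) :=
  (Measure.pi fun s : PooledIndex n => (P s.1 : Measure 𝒳)).prod
    (Measure.pi fun _ : Fin M => uniformOn (Set.univ : Set (Equiv.Perm (PooledIndex n))))

/-- The type II error `ℙ(φ_{K,MC} = 0)` at `P = (P_1, …, P_K)`. -/
def typeIIErrorMC {K : ℕ} (n : Fin K → ℕ) (M : ℕ) (α : ℝ)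
    (P : Fin K → ProbabilityMeasure 𝒳) : ℝ≥0∞ :=
  jointLaw n M P {ω | testMC H n M α ω.1 ω.2 = 0}

/-- The sparse alternatives: all `(P_1, …, P_K)` such that the maximal pairwise maximum mean
discrepancy is at least `ε`. -/
def sparseAlternatives (K : ℕ) (ε : ℝ) : Set (Fin K → ProbabilityMeasure 𝒳) :=
  {P | ε ≤ ⨆ p : {p : Fin K × Fin K // p.1 < p.2},
    mmd H (P p.1.1 : Measure 𝒳) (P p.1.2 : Measure 𝒳)}

end Statistic

end

end KSampleMMD

/-!
Fix a level `t`. The test can only accept if the observed statistic is below `t`, or if at least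
`α (M + 1) - 1` of the `M` permuted statistics are at least `t` (`le_sum_of_testMC_eq_zero`). With
`2 t = b_N r_N^⋆` both events become negligible, the second one as soon as `α (M + 1) > 1`; for each
such `M` the inner limit is therefore already zero.

* The observed statistic (`pi_statMax_lt_le`). Take two samples whose mean embeddings are at least
  `2 t` apart and project the difference of their empirical embeddings on the direction `e` of the
  population difference. This is a real sum of independent variables bounded by a multiple of `√B`,
  with mean at least `2 t` and variance at most `2 B / n_min`; Chebyshev's inequality applies.

* The permuted statistic (`uniformOn_perm_le_statMax_le`). For a fixed pooled sample and two groups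
  of sizes `m ≤ r`, the difference of the permuted averages is the mean over cyclic shifts of averages
  of `m` paired differences (`average_sub_average_eq_sum_shifts`), so by convexity it is enough to
  bound the exponential moment of a sum of paired differences. Exchanging the two members of one pair
  leaves the uniform law on permutations invariant, so each pair acts as a symmetric random sign, and
  Pinelis' inequality `cosh ‖x + v‖ + cosh ‖x - v‖ ≤ 2 cosh ‖x‖ cosh ‖v‖`
  (`cosh_norm_add_add_cosh_norm_sub_le`) gives a dimension-free Hoeffding bound. A union bound over
  the fewer than `K²` pairs of samples costs a factor that `exp (-b_N² log K / (16 B))` absorbs.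

The two bounds are combined by Markov's inequality under the joint law (`typeIIErrorMC_le`).
-/

namespace KSampleMMD

/-! ### Hyperbolic cosines of norms -/

theorem add_pow_add_sub_pow_le {a p q : ℝ} (hpq : |p| ≤ q) (hqa : q ≤ a) (m : ℕ) :
    (a + p) ^ m + (a - p) ^ m ≤ (a + q) ^ m + (a - q) ^ m := by
  obtain ⟨hp1, hp2⟩ := abs_le.1 hpq
  rcases (le_trans (abs_nonneg p) hpq).eq_or_lt with hq | hq
  · have hp : p = 0 := by linarith
    rw [hp, ← hq]
  have hc := convexOn_pow (𝕜 := ℝ) m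
  have hx : a + q ∈ Set.Ici (0 : ℝ) := by simp only [Set.mem_Ici]; linarith
  have hy : a - q ∈ Set.Ici (0 : ℝ) := by simp only [Set.mem_Ici]; linarith
  have h0 : 0 ≤ (q + p) / (2 * q) := div_nonneg (by linarith) (by linarith)
  have h1 : 0 ≤ (q - p) / (2 * q) := div_nonneg (by linarith) (by linarith)
  have e1 := hc.2 hx hy h0 h1 (by field_simp; ring)
  have e2 := hc.2 hx hy h1 h0 (by field_simp; ring)
  simp only [smul_eq_mul] at e1 e2
  have i1 : (q + p) / (2 * q) * (a + q) + (q - p) / (2 * q) * (a - q) = a + p := by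
    field_simp; ring
  have i2 : (q - p) / (2 * q) * (a + q) + (q + p) / (2 * q) * (a - q) = a - p := by
    field_simp; ring
  rw [i1] at e1
  rw [i2] at e2
  have i3 : (q + p) / (2 * q) + (q - p) / (2 * q) = 1 := by field_simp; ring
  calc (a + p) ^ m + (a - p) ^ m
      ≤ ((q + p) / (2 * q) + (q - p) / (2 * q)) * ((a + q) ^ m + (a - q) ^ m) := by linarith
    _ = _ := by rw [i3, one_mul]

/-- Pinelis' inequality in a Hilbert space: a symmetric step `±v` multiplies the mean of
`cosh ‖·‖` by at most `cosh ‖v‖`. As `‖x ± v‖² = ‖x‖² + ‖v‖² ± 2⟪x, v⟫` and `s ↦ cosh √s` is a power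
series with nonnegative coefficients, the left-hand side is largest for parallel `x` and `v`, where
it is the addition formula for `cosh`. -/
theorem cosh_norm_add_add_cosh_norm_sub_le {E : Type*} [NormedAddCommGroup E]
    [InnerProductSpace ℝ E] (x v : E) :
    Real.cosh ‖x + v‖ + Real.cosh ‖x - v‖ ≤ 2 * (Real.cosh ‖x‖ * Real.cosh ‖v‖) := by
  have hs : 2 * (Real.cosh ‖x‖ * Real.cosh ‖v‖) =
      Real.cosh (‖x‖ + ‖v‖) + Real.cosh (‖x‖ - ‖v‖) := by
    rw [Real.cosh_add, Real.cosh_sub]; ring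
  rw [hs]
  refine hasSum_le (fun m => ?_) ((Real.hasSum_cosh _).add (Real.hasSum_cosh _))
    ((Real.hasSum_cosh _).add (Real.hasSum_cosh _))
  rw [← add_div, ← add_div]
  refine div_le_div_of_nonneg_right ?_ (by positivity)
  simp only [pow_mul]
  have h1 : ‖x + v‖ ^ 2 = (‖x‖ ^ 2 + ‖v‖ ^ 2) + 2 * ⟪x, v⟫ := by
    rw [norm_add_sq_real]; ring
  have h2 : ‖x - v‖ ^ 2 = (‖x‖ ^ 2 + ‖v‖ ^ 2) - 2 * ⟪x, v⟫ := by
    rw [norm_sub_sq_real]; ring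
  have h3 : (‖x‖ + ‖v‖) ^ 2 = (‖x‖ ^ 2 + ‖v‖ ^ 2) + 2 * (‖x‖ * ‖v‖) := by ring
  have h4 : (‖x‖ - ‖v‖) ^ 2 = (‖x‖ ^ 2 + ‖v‖ ^ 2) - 2 * (‖x‖ * ‖v‖) := by ring
  rw [h1, h2, h3, h4]
  refine add_pow_add_sub_pow_le ?_ (by nlinarith [sq_nonneg (‖x‖ - ‖v‖)]) m
  rw [abs_mul, abs_two]
  gcongr
  exact abs_real_inner_le_norm x v

theorem convexOn_cosh : ConvexOn ℝ Set.univ Real.cosh := by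
  refine ⟨convex_univ, fun x _ y _ a b ha hb hab => ?_⟩
  have h1 := convexOn_exp.2 (Set.mem_univ x) (Set.mem_univ y) ha hb hab
  have h2 := convexOn_exp.2 (Set.mem_univ (-x)) (Set.mem_univ (-y)) ha hb hab
  simp only [smul_eq_mul] at *
  rw [Real.cosh_eq, Real.cosh_eq, Real.cosh_eq,
    show -(a * x + b * y) = a * -x + b * -y by ring]
  linarith

theorem cosh_norm_sum_smul_le {E ι : Type*} [NormedAddCommGroup E] [NormedSpace ℝ E]
    [Fintype ι] {w : ι → ℝ} (hw : ∀ i, 0 ≤ w i) (hw1 : ∑ i, w i = 1) (v : ι → E) :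
    Real.cosh ‖∑ i, w i • v i‖ ≤ ∑ i, w i * Real.cosh ‖v i‖ := by
  have h1 : ‖∑ i, w i • v i‖ ≤ ∑ i, w i • ‖v i‖ := by
    refine (norm_sum_le _ _).trans (Finset.sum_le_sum fun i _ => ?_)
    rw [norm_smul, Real.norm_of_nonneg (hw i), smul_eq_mul]
  refine le_trans (Real.cosh_le_cosh.2 (abs_le_abs_of_nonneg (norm_nonneg _) h1)) ?_
  exact convexOn_cosh.map_sum_le (fun i _ => hw i) hw1 fun i _ => Set.mem_univ _

/-! ### Uniformly permuted differences -/

/-- Exponential moment bound for a sum of paired differences under a uniform permutation. Composing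
`b` with the transposition of `p j` and `q j` preserves the uniform law, flips the sign of the
`j`-th difference and leaves the others unchanged, so each pair is a symmetric step. -/
theorem sum_perm_cosh_norm_le {E S ι : Type*} [NormedAddCommGroup E] [InnerProductSpace ℝ E]
    [Fintype S] [DecidableEq S] {w : S → E} {D : ℝ} (hD : ∀ s t, ‖w s - w t‖ ≤ D)
    {p q : ι → S} (hp : Function.Injective p) (hq : Function.Injective q)
    (hpq : ∀ i j, p i ≠ q j) (A : Finset ι) :
    ∑ b : Equiv.Perm S, Real.cosh ‖∑ i ∈ A, (w (b (p i)) - w (b (q i)))‖ ≤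
      Fintype.card (Equiv.Perm S) * Real.cosh D ^ A.card := by
  classical
  induction A using Finset.induction_on with
  | empty => simp
  | insert j A hj ih =>
    set R : Equiv.Perm S → E := fun b => ∑ i ∈ A, (w (b (p i)) - w (b (q i))) with hR
    set u : Equiv.Perm S → E := fun b => w (b (p j)) - w (b (q j)) with hu
    have hsum : ∀ b : Equiv.Perm S,
        ∑ i ∈ insert j A, (w (b (p i)) - w (b (q i))) = R b + u b := fun b => by
      rw [Finset.sum_insert hj, add_comm]
    have hswap : ∀ b : Equiv.Perm S,
        R (b * Equiv.swap (p j) (q j)) + u (b * Equiv.swap (p j) (q j)) = R b - u b := by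
      intro b
      have hu' : u (b * Equiv.swap (p j) (q j)) = - u b := by
        simp [hu]
      have hR' : R (b * Equiv.swap (p j) (q j)) = R b := by
        refine Finset.sum_congr rfl fun i hi => ?_
        have hij : i ≠ j := fun h => hj (h ▸ hi)
        simp only [Equiv.Perm.mul_apply]
        rw [Equiv.swap_apply_of_ne_of_ne (hp.ne hij) (hpq i j),
          Equiv.swap_apply_of_ne_of_ne (hpq j i).symm (hq.ne hij)]
      rw [hu', hR', sub_eq_add_neg]
    have hD0 : ∀ b, Real.cosh ‖u b‖ ≤ Real.cosh D := fun b =>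
      Real.cosh_le_cosh.2 (abs_le_abs_of_nonneg (norm_nonneg _) (hD _ _))
    have hinv : ∑ b : Equiv.Perm S, Real.cosh ‖R b - u b‖ =
        ∑ b : Equiv.Perm S, Real.cosh ‖R b + u b‖ := by
      rw [← Equiv.sum_comp (Equiv.mulRight (Equiv.swap (p j) (q j)))
        (fun b => Real.cosh ‖R b + u b‖)]
      refine Finset.sum_congr rfl fun b _ => ?_
      rw [Equiv.coe_mulRight, hswap]
    simp_rw [hsum]
    rw [Finset.card_insert_of_notMem hj]
    have hmain : ∑ b : Equiv.Perm S, (Real.cosh ‖R b + u b‖ + Real.cosh ‖R b - u b‖) ≤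
        ∑ b : Equiv.Perm S, 2 * (Real.cosh ‖R b‖ * Real.cosh D) := by
      refine Finset.sum_le_sum fun b _ =>
        (cosh_norm_add_add_cosh_norm_sub_le _ _).trans ?_
      have := mul_le_mul_of_nonneg_left (hD0 b) (Real.cosh_pos ‖R b‖).le
      linarith
    rw [Finset.sum_add_distrib, hinv, ← Finset.mul_sum, ← Finset.sum_mul] at hmain
    have := mul_le_mul_of_nonneg_right ih (Real.cosh_pos D).le
    calc _ ≤ (∑ b : Equiv.Perm S, Real.cosh ‖R b‖) * Real.cosh D := by linarith
      _ ≤ _ := this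
      _ = _ := by ring

/-- The difference of the averages of `f` over `Fin m` and of `g` over `Fin r`, `m ≤ r`, is the mean
over the cyclic shifts of `Fin r` of an average of `m` paired differences. -/
theorem average_sub_average_eq_sum_shifts {E : Type*} [AddCommGroup E] [Module ℝ E]
    {m r : ℕ} [NeZero r] (hm : 0 < m) (hmr : m ≤ r) (f : Fin m → E) (g : Fin r → E) :
    (m : ℝ)⁻¹ • ∑ i, f i - (r : ℝ)⁻¹ • ∑ j, g j =
      ∑ s : Fin r, (r : ℝ)⁻¹ • ((m : ℝ)⁻¹ • ∑ i, (f i - g (Fin.castLE hmr i + s))) := by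
  have hm' : (m : ℝ) ≠ 0 := by positivity
  have hr' : (r : ℝ) ≠ 0 := Nat.cast_ne_zero.2 (NeZero.ne r)
  have hg : ∑ s : Fin r, ∑ i : Fin m, g (Fin.castLE hmr i + s) = (m : ℝ) • ∑ j, g j := by
    rw [Finset.sum_comm]
    have : ∀ i : Fin m, ∑ s : Fin r, g (Fin.castLE hmr i + s) = ∑ j, g j := fun i =>
      Equiv.sum_comp (Equiv.addLeft (Fin.castLE hmr i)) g
    simp_rw [this]
    simp [← Nat.cast_smul_eq_nsmul ℝ]
  rw [← Finset.smul_sum, ← Finset.smul_sum]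
  simp_rw [Finset.sum_sub_distrib]
  rw [hg, smul_sub, smul_sub, smul_smul _ (m : ℝ), inv_mul_cancel₀ hm', one_smul]
  congr 1
  rw [Finset.sum_const, Finset.card_univ, Fintype.card_fin, ← Nat.cast_smul_eq_nsmul ℝ,
    smul_smul, smul_smul, mul_right_comm, inv_mul_cancel₀ hr', one_mul]

theorem sum_perm_cosh_average_sub_average_le {E S : Type*} [NormedAddCommGroup E]
    [InnerProductSpace ℝ E] [Fintype S] [DecidableEq S] {w : S → E} {D : ℝ}
    (hD : ∀ s t, ‖w s - w t‖ ≤ D) {m r : ℕ} (hm : 0 < m) (hmr : m ≤ r)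
    {p : Fin m → S} {q : Fin r → S} (hp : Function.Injective p) (hq : Function.Injective q)
    (hpq : ∀ i j, p i ≠ q j) {a : ℝ} (ha : 0 ≤ a) :
    ∑ b : Equiv.Perm S, Real.cosh (a * m *
        ‖(m : ℝ)⁻¹ • ∑ i, w (b (p i)) - (r : ℝ)⁻¹ • ∑ j, w (b (q j))‖) ≤
      Fintype.card (Equiv.Perm S) * Real.exp (m * ((a * D) ^ 2 / 2)) := by
  have : NeZero r := ⟨by omega⟩
  have hr' : (r : ℝ) ≠ 0 := Nat.cast_ne_zero.2 (NeZero.ne r)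
  have hm' : (m : ℝ) ≠ 0 := by positivity
  have hw1 : ∑ _s : Fin r, (r : ℝ)⁻¹ = 1 := by simp [hr']
  have hstep : ∀ b : Equiv.Perm S, Real.cosh (a * m *
        ‖(m : ℝ)⁻¹ • ∑ i, w (b (p i)) - (r : ℝ)⁻¹ • ∑ j, w (b (q j))‖) ≤
      ∑ s : Fin r, (r : ℝ)⁻¹ *
        Real.cosh ‖∑ i, (a • w (b (p i)) - a • w (b (q (Fin.castLE hmr i + s))))‖ := by
    intro b
    rw [← Real.norm_of_nonneg (show 0 ≤ a * m by positivity), ← norm_smul,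
      average_sub_average_eq_sum_shifts hm hmr, Finset.smul_sum]
    refine le_of_eq_of_le ?_ (cosh_norm_sum_smul_le (fun _ => by positivity) hw1 _)
    congr 3
    ext s
    simp_rw [← smul_sub]
    rw [← Finset.smul_sum, smul_smul, smul_smul, smul_smul]
    congr 1
    field_simp
  have hD' : ∀ s t, ‖a • w s - a • w t‖ ≤ a * D := fun s t => by
    rw [← smul_sub, norm_smul, Real.norm_of_nonneg ha]
    exact mul_le_mul_of_nonneg_left (hD s t) ha
  refine (Finset.sum_le_sum fun b _ => hstep b).trans ?_
  rw [Finset.sum_comm]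
  simp_rw [← Finset.mul_sum]
  rw [Finset.mul_sum]
  calc ∑ s : Fin r, (r : ℝ)⁻¹ * ∑ b : Equiv.Perm S,
        Real.cosh ‖∑ i, (a • w (b (p i)) - a • w (b (q (Fin.castLE hmr i + s))))‖
      ≤ ∑ s : Fin r, (r : ℝ)⁻¹ * (Fintype.card (Equiv.Perm S) * Real.cosh (a * D) ^ m) := by
        refine Finset.sum_le_sum fun s _ => mul_le_mul_of_nonneg_left ?_ (by positivity)
        have := sum_perm_cosh_norm_le hD' (p := p) (q := fun i => q (Fin.castLE hmr i + s)) hp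
          (fun i j h => Fin.castLE_injective hmr (add_right_cancel (hq h)))
          (fun i j => hpq i _) Finset.univ
        simpa using this
    _ = Fintype.card (Equiv.Perm S) * Real.cosh (a * D) ^ m := by
        rw [← Finset.sum_mul, hw1, one_mul]
    _ ≤ Fintype.card (Equiv.Perm S) * Real.exp ((a * D) ^ 2 / 2) ^ m := by
        gcongr
        exact Real.cosh_le_exp_half_sq _
    _ = _ := by rw [← Real.exp_nat_mul]

open scoped Classical in
/-- Hoeffding-type tail bound: the number of permutations for which two permuted averages are at
least `t` apart. -/
theorem card_perm_le_norm_average_sub_average_le {E S : Type*} [NormedAddCommGroup E]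
    [InnerProductSpace ℝ E] [Fintype S] [DecidableEq S] {w : S → E} {D : ℝ} (hD0 : 0 < D)
    (hD : ∀ s t, ‖w s - w t‖ ≤ D) {m r : ℕ} (hm : 0 < m) (hmr : m ≤ r)
    {p : Fin m → S} {q : Fin r → S} (hp : Function.Injective p) (hq : Function.Injective q)
    (hpq : ∀ i j, p i ≠ q j) {t : ℝ} (ht : 0 ≤ t) :
    ((Finset.univ.filter fun b : Equiv.Perm S =>
        t ≤ ‖(m : ℝ)⁻¹ • ∑ i, w (b (p i)) - (r : ℝ)⁻¹ • ∑ j, w (b (q j))‖).card : ℝ) ≤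
      Fintype.card (Equiv.Perm S) * (2 * Real.exp (-(m * t ^ 2 / (2 * D ^ 2)))) := by
  -- `a = t / D²` minimises the Chernoff exponent `m (a D)² / 2 - a m t`.
  have key := sum_perm_cosh_average_sub_average_le hD hm hmr hp hq hpq
    (a := t / D ^ 2) (by positivity)
  set F := Finset.univ.filter fun b : Equiv.Perm S =>
        t ≤ ‖(m : ℝ)⁻¹ • ∑ i, w (b (p i)) - (r : ℝ)⁻¹ • ∑ j, w (b (q j))‖ with hF
  have h1 : (F.card : ℝ) * (Real.exp (m * t ^ 2 / D ^ 2) / 2) ≤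
      Fintype.card (Equiv.Perm S) * Real.exp (m * ((t / D ^ 2 * D) ^ 2 / 2)) := by
    refine le_trans ?_ key
    rw [← nsmul_eq_mul]
    refine le_trans (Finset.card_nsmul_le_sum F _ _ fun b hb => ?_)
      (Finset.sum_le_sum_of_subset_of_nonneg (Finset.subset_univ F)
        fun b _ _ => (Real.cosh_pos _).le)
    have hb' := (Finset.mem_filter.1 hb).2
    have h2 : m * t ^ 2 / D ^ 2 ≤ t / D ^ 2 * m *
        ‖(m : ℝ)⁻¹ • ∑ i, w (b (p i)) - (r : ℝ)⁻¹ • ∑ j, w (b (q j))‖ := by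
      calc m * t ^ 2 / D ^ 2 = t / D ^ 2 * m * t := by ring
        _ ≤ _ := by gcongr
    rw [Real.cosh_eq]
    have := Real.exp_le_exp.2 h2
    have := Real.exp_pos (-(t / D ^ 2 * m *
        ‖(m : ℝ)⁻¹ • ∑ i, w (b (p i)) - (r : ℝ)⁻¹ • ∑ j, w (b (q j))‖))
    linarith
  have e1 : Real.exp (m * ((t / D ^ 2 * D) ^ 2 / 2)) =
      Real.exp (-(m * t ^ 2 / (2 * D ^ 2))) * Real.exp (m * t ^ 2 / D ^ 2) := by
    rw [← Real.exp_add]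
    congr 1
    field_simp
    ring
  rw [e1] at h1
  have hpos := Real.exp_pos (m * t ^ 2 / D ^ 2)
  refine le_of_mul_le_mul_right ?_ hpos
  linarith

/-! ### Empirical mean embeddings and measurability of the test -/

section Empirical

variable {𝒳 : Type*} (H : Type*) [NormedAddCommGroup H] [InnerProductSpace ℝ H] [CompleteSpace H]
  [RKHS ℝ H 𝒳 ℝ]

/-- The empirical mean embedding of the `k`-th sample of the pooled sample `Z`. -/
noncomputable def empMean {K : ℕ} (n : Fin K → ℕ) (k : Fin K) (Z : PooledIndex n → 𝒳) : H :=
  (n k : ℝ)⁻¹ • ∑ i : Fin (n k), featureMap H (Z ⟨k, i⟩)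

theorem norm_empMean_sub_le_statMax {K : ℕ} (n : Fin K → ℕ) (Z : PooledIndex n → 𝒳)
    {k l : Fin K} (hkl : k < l) : ‖empMean H n k Z - empMean H n l Z‖ ≤ statMax H n Z :=
  le_ciSup (f := fun p : {p : Fin K × Fin K // p.1 < p.2} =>
    ‖empMean H n p.1.1 Z - empMean H n p.1.2 Z‖) (Set.finite_range _).bddAbove ⟨(k, l), hkl⟩

theorem nonempty_pairs {K : ℕ} (hK : 2 ≤ K) : Nonempty {p : Fin K × Fin K // p.1 < p.2} :=
  ⟨⟨(⟨0, by omega⟩, ⟨1, by omega⟩), by simp [Fin.lt_def]⟩⟩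

theorem exists_statMax_eq {K : ℕ} (hK : 2 ≤ K) (n : Fin K → ℕ) (Z : PooledIndex n → 𝒳) :
    ∃ p : {p : Fin K × Fin K // p.1 < p.2},
      statMax H n Z = ‖empMean H n p.1.1 Z - empMean H n p.1.2 Z‖ := by
  have := nonempty_pairs hK
  obtain ⟨p, hp⟩ := exists_eq_ciSup_of_finite
    (f := fun p : {p : Fin K × Fin K // p.1 < p.2} =>
      ‖empMean H n p.1.1 Z - empMean H n p.1.2 Z‖)
  exact ⟨p, hp.symm⟩

theorem nMin_le {K : ℕ} (n : Fin K → ℕ) (k : Fin K) : nMin n ≤ n k :=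
  ciInf_le (OrderBot.bddBelow _) k

variable {H}

theorem norm_featureMap_le {B : ℝ} (hB : ∀ x y : 𝒳, 0 ≤ rkernel H x y ∧ rkernel H x y ≤ B)
    (x : 𝒳) : ‖featureMap H x‖ ≤ √B := by
  refine Real.le_sqrt_of_sq_le ?_
  rw [← real_inner_self_eq_norm_sq, inner_featureMap]
  exact (hB x x).2

theorem norm_featureMap_sub_le {B : ℝ} (hB : ∀ x y : 𝒳, 0 ≤ rkernel H x y ∧ rkernel H x y ≤ B)
    (x y : 𝒳) : ‖featureMap H x - featureMap H y‖ ≤ √(2 * B) := by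
  refine Real.le_sqrt_of_sq_le ?_
  rw [norm_sub_sq_real, ← real_inner_self_eq_norm_sq, ← real_inner_self_eq_norm_sq,
    inner_featureMap, inner_featureMap, inner_featureMap]
  linarith [(hB x x).2, (hB y y).2, (hB x y).1]

variable [MeasurableSpace 𝒳]

/-- The feature map need not be strongly measurable, but norms of its linear combinations are
measurable because they are polynomials in values of the kernel. -/
theorem measurable_norm_empMean_sub (hm : Measurable fun p : 𝒳 × 𝒳 => rkernel H p.1 p.2)
    {K : ℕ} (n : Fin K → ℕ) (k l : Fin K) :
    Measurable fun Z : PooledIndex n → 𝒳 => ‖empMean H n k Z - empMean H n l Z‖ := by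
  have hin : ∀ k l : Fin K, Measurable fun Z : PooledIndex n → 𝒳 =>
      ⟪empMean H n k Z, empMean H n l Z⟫ := by
    intro k l
    simp only [empMean, real_inner_smul_left, real_inner_smul_right, sum_inner, inner_sum,
      inner_featureMap]
    have hker : ∀ (i : Fin (n k)) (j : Fin (n l)), Measurable fun Z : PooledIndex n → 𝒳 =>
        rkernel H (Z ⟨k, i⟩) (Z ⟨l, j⟩) := fun i j =>
      hm.comp (f := fun Z : PooledIndex n → 𝒳 => (Z ⟨k, i⟩, Z ⟨l, j⟩))
        ((measurable_pi_apply _).prodMk (measurable_pi_apply _))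
    fun_prop
  simp only [norm_eq_sqrt_real_inner, inner_sub_left, inner_sub_right]
  exact (((hin k k).sub (hin l k)).sub ((hin k l).sub (hin l l))).sqrt

theorem measurable_statMax (hm : Measurable fun p : 𝒳 × 𝒳 => rkernel H p.1 p.2)
    {K : ℕ} (n : Fin K → ℕ) : Measurable (statMax (𝒳 := 𝒳) H n) :=
  Measurable.iSup (f := fun (p : {p : Fin K × Fin K // p.1 < p.2}) (Z : PooledIndex n → 𝒳) =>
    ‖empMean H n p.1.1 Z - empMean H n p.1.2 Z‖)
    fun p => measurable_norm_empMean_sub hm n p.1.1 p.1.2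

end Empirical

/-! ### The permutation distribution -/

section Permutation

variable {𝒳 : Type*} {H : Type*} [NormedAddCommGroup H] [InnerProductSpace ℝ H] [CompleteSpace H]
  [RKHS ℝ H 𝒳 ℝ]

open scoped Classical in
theorem card_perm_le_norm_empMean_sub_le {B : ℝ} (hB0 : 0 < B)
    (hB : ∀ x y : 𝒳, 0 ≤ rkernel H x y ∧ rkernel H x y ≤ B)
    {K : ℕ} {n : Fin K → ℕ} (hn : ∀ k, 0 < n k) {k l : Fin K} (hkl : k ≠ l)
    (Z : PooledIndex n → 𝒳) {t : ℝ} (ht : 0 ≤ t) :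
    ((Finset.univ.filter fun b : Equiv.Perm (PooledIndex n) =>
        t ≤ ‖empMean H n k (fun s => Z (b s)) - empMean H n l (fun s => Z (b s))‖).card : ℝ) ≤
      Fintype.card (Equiv.Perm (PooledIndex n)) *
        (2 * Real.exp (-(nMin n * t ^ 2 / (4 * B)))) := by
  wlog hle : n k ≤ n l generalizing k l
  · have := this hkl.symm (by omega)
    simp_rw [norm_sub_rev (empMean H n l _)] at this
    exact this
  have key := card_perm_le_norm_average_sub_average_le (w := fun s => featureMap H (Z s))
    (D := √(2 * B)) (by positivity) (fun s t => norm_featureMap_sub_le hB _ _) (hn k) hle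
    (p := fun i => (⟨k, i⟩ : PooledIndex n)) (q := fun j => (⟨l, j⟩ : PooledIndex n))
    (fun i j h => by simpa using h) (fun i j h => by simpa using h) (fun i j h => hkl (congrArg Sigma.fst h)) ht
  refine key.trans ?_
  rw [Real.sq_sqrt (by positivity), show 2 * (2 * B) = 4 * B by ring]
  have := nMin_le n k
  gcongr

/-- For every pooled sample, the permuted statistic has subgaussian tails at scale `n_min⁻¹ᐟ²`, up
to a union bound over the pairs of samples. -/
theorem uniformOn_perm_le_statMax_le {B : ℝ} (hB0 : 0 < B)
    (hB : ∀ x y : 𝒳, 0 ≤ rkernel H x y ∧ rkernel H x y ≤ B)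
    {K : ℕ} (hK : 2 ≤ K) {n : Fin K → ℕ} (hn : ∀ k, 0 < n k)
    (Z : PooledIndex n → 𝒳) {t : ℝ} (ht : 0 ≤ t) :
    uniformOn (Set.univ : Set (Equiv.Perm (PooledIndex n)))
        {b | t ≤ statMax H n fun s => Z (b s)} ≤
      ENNReal.ofReal (2 * K ^ 2 * Real.exp (-(nMin n * t ^ 2 / (4 * B)))) := by
  classical
  set F := Finset.univ.filter fun b : Equiv.Perm (PooledIndex n) =>
    t ≤ statMax H n fun s => Z (b s) with hF
  set G := fun p : {p : Fin K × Fin K // p.1 < p.2} =>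
    Finset.univ.filter fun b : Equiv.Perm (PooledIndex n) =>
      t ≤ ‖empMean H n p.1.1 (fun s => Z (b s)) - empMean H n p.1.2 (fun s => Z (b s))‖ with hG
  have hsub : F ⊆ Finset.univ.biUnion G := by
    intro b hb
    obtain ⟨p, hp⟩ := exists_statMax_eq H hK n fun s => Z (b s)
    have hb' := (Finset.mem_filter.1 hb).2
    rw [hp] at hb'
    exact Finset.mem_biUnion.2 ⟨p, Finset.mem_univ _, Finset.mem_filter.2 ⟨Finset.mem_univ _, hb'⟩⟩
  have hpairs : (Fintype.card {p : Fin K × Fin K // p.1 < p.2} : ℝ) ≤ K ^ 2 := by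
    have := Fintype.card_subtype_le fun p : Fin K × Fin K => p.1 < p.2
    rw [Fintype.card_prod, Fintype.card_fin, ← sq] at this
    exact_mod_cast this
  set N := Fintype.card (Equiv.Perm (PooledIndex n)) with hN
  have hNpos : (0 : ℝ) < N := by exact_mod_cast Fintype.card_pos
  have hcard : (F.card : ℝ) ≤
      2 * K ^ 2 * Real.exp (-(nMin n * t ^ 2 / (4 * B))) * N := by
    calc (F.card : ℝ) ≤ ∑ p, ((G p).card : ℝ) := by
          exact_mod_cast (Finset.card_le_card hsub).trans Finset.card_biUnion_le
      _ ≤ ∑ _p : {p : Fin K × Fin K // p.1 < p.2},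
            N * (2 * Real.exp (-(nMin n * t ^ 2 / (4 * B)))) :=
          Finset.sum_le_sum fun p _ =>
            card_perm_le_norm_empMean_sub_le hB0 hB hn p.2.ne Z ht
      _ = Fintype.card {p : Fin K × Fin K // p.1 < p.2} *
            (N * (2 * Real.exp (-(nMin n * t ^ 2 / (4 * B))))) := by
          rw [Finset.sum_const, nsmul_eq_mul, Finset.card_univ]
      _ ≤ K ^ 2 * (N * (2 * Real.exp (-(nMin n * t ^ 2 / (4 * B))))) := by gcongr
      _ = _ := by ring
  have hset : {b : Equiv.Perm (PooledIndex n) | t ≤ statMax H n fun s => Z (b s)} = ↑F := by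
    ext b; simp [hF]
  rw [hset, uniformOn_univ, Measure.count_apply_finset, ← hN]
  refine ENNReal.div_le_of_le_mul ?_
  rw [← ENNReal.ofReal_natCast, ← ENNReal.ofReal_natCast, ← ENNReal.ofReal_mul (by positivity)]
  exact ENNReal.ofReal_le_ofReal hcard

end Permutation

/-! ### The observed statistic under the alternative -/

section Data

variable {𝒳 : Type*} {H : Type*} [NormedAddCommGroup H] [InnerProductSpace ℝ H] [CompleteSpace H]
  [RKHS ℝ H 𝒳 ℝ]

/-- The weights of the contrast between the averages of the `k`-th and the `l`-th sample. -/
noncomputable def contrast {K : ℕ} (n : Fin K → ℕ) (k l : Fin K) (s : PooledIndex n) : ℝ :=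
  (if s.1 = k then (n k : ℝ)⁻¹ else 0) - (if s.1 = l then (n l : ℝ)⁻¹ else 0)

theorem sum_contrast_mul {K : ℕ} (n : Fin K → ℕ) (k l : Fin K) (f : PooledIndex n → ℝ) :
    ∑ s, contrast n k l s * f s =
      (n k : ℝ)⁻¹ * ∑ i, f ⟨k, i⟩ - (n l : ℝ)⁻¹ * ∑ j, f ⟨l, j⟩ := by
  simp only [contrast, sub_mul, Finset.sum_sub_distrib, Fintype.sum_sigma, ite_mul, zero_mul]
  congr 1
  · rw [Finset.sum_eq_single k]
    · simp [Finset.mul_sum]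
    · intro j _ hj; simp [hj]
    · simp
  · rw [Finset.sum_eq_single l]
    · simp [Finset.mul_sum]
    · intro j _ hj; simp [hj]
    · simp

theorem sum_contrast_sq {K : ℕ} {n : Fin K → ℕ} (hn : ∀ k, 0 < n k) {k l : Fin K} (hkl : k ≠ l) :
    ∑ s, contrast n k l s ^ 2 = (n k : ℝ)⁻¹ + (n l : ℝ)⁻¹ := by
  have hk : (n k : ℝ) ≠ 0 := by exact_mod_cast (hn k).ne'
  have hl : (n l : ℝ) ≠ 0 := by exact_mod_cast (hn l).ne'
  simp_rw [sq]
  rw [sum_contrast_mul]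
  simp [contrast, hkl, hkl.symm, hk, hl]

variable [MeasurableSpace 𝒳]

/-- Under the alternative the observed statistic is large: project the difference of the empirical
embeddings of the best separated pair of samples on the direction of the population difference, and
apply Chebyshev's inequality to this real random variable. -/
theorem pi_statMax_lt_le (hm : Measurable fun p : 𝒳 × 𝒳 => rkernel H p.1 p.2)
    {B : ℝ} (hB : ∀ x y : 𝒳, 0 ≤ rkernel H x y ∧ rkernel H x y ≤ B) (hB0 : 0 < B)
    {K : ℕ} (hK : 2 ≤ K) {n : Fin K → ℕ} (hn : ∀ k, 0 < n k) (hmin : 0 < nMin n)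
    {P : Fin K → ProbabilityMeasure 𝒳} {t : ℝ} (ht : 0 < t)
    (hP : P ∈ sparseAlternatives (𝒳 := 𝒳) H K (2 * t)) :
    (Measure.pi fun s : PooledIndex n => (P s.1 : Measure 𝒳)) {Z | statMax H n Z < t} ≤
      ENNReal.ofReal (2 * B / (nMin n * t ^ 2)) := by
  have := nonempty_pairs hK
  obtain ⟨⟨⟨k, l⟩, hkl⟩, hp⟩ := exists_eq_ciSup_of_finite
    (f := fun p : {p : Fin K × Fin K // p.1 < p.2} =>
      mmd H (P p.1.1 : Measure 𝒳) (P p.1.2 : Measure 𝒳))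
  change 2 * t ≤ _ at hP
  rw [← hp] at hP
  dsimp only at hP hkl
  set u : H := meanEmbedding H (P k : Measure 𝒳) - meanEmbedding H (P l : Measure 𝒳) with hu
  change 2 * t ≤ ‖u‖ at hP
  have hu0 : ‖u‖ ≠ 0 := by linarith
  set e : H := ‖u‖⁻¹ • u with he
  have he1 : ‖e‖ = 1 := by rw [he, norm_smul, norm_inv, norm_norm, inv_mul_cancel₀ hu0]
  have hue : ⟪u, e⟫ = ‖u‖ := by
    rw [he, real_inner_smul_right, real_inner_self_eq_norm_sq]
    field_simp
  have hem : Measurable fun x => e x := measurable_coe H hm e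
  have heB : ∀ x : 𝒳, |e x| ≤ √B := fun x => by
    rw [← inner_featureMap_left]
    refine (abs_real_inner_le_norm _ _).trans ?_
    rw [he1, mul_one]
    exact norm_featureMap_le hB x
  set g : PooledIndex n → 𝒳 → ℝ := fun s x => contrast n k l s * e x with hg
  have heL : ∀ s : PooledIndex n, MemLp (fun x => e x) 2 (P s.1 : Measure 𝒳) := fun s =>
    MemLp.of_bound hem.aestronglyMeasurable (√B) (Eventually.of_forall heB)
  have hgL : ∀ s, MemLp (g s) 2 (P s.1 : Measure 𝒳) := fun s => (heL s).const_mul _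
  set μ := Measure.pi fun s : PooledIndex n => (P s.1 : Measure 𝒳) with hμ
  set Y : (PooledIndex n → 𝒳) → ℝ := ∑ s, fun Z => g s (Z s) with hY
  have hYL : MemLp Y 2 μ := memLp_finsetSum' _ fun s _ =>
    (hgL s).comp_measurePreserving (measurePreserving_eval _ s)
  have hYval : ∀ Z, Y Z = ⟪empMean H n k Z - empMean H n l Z, e⟫ := by
    intro Z
    rw [hY, Finset.sum_apply]
    simp only [hg]
    rw [sum_contrast_mul n k l fun s => e (Z s)]
    simp only [empMean, inner_sub_left, real_inner_smul_left, sum_inner, inner_featureMap_left]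
  have hmean : ∫ Z, Y Z ∂μ = ‖u‖ := by
    have h1 : ∫ Z, Y Z ∂μ = ∑ s : PooledIndex n, contrast n k l s *
        ∫ x, e x ∂(P s.1 : Measure 𝒳) := by
      simp only [hY, Finset.sum_apply]
      rw [integral_finsetSum]
      · refine Finset.sum_congr rfl fun s _ => ?_
        rw [hμ, integral_comp_eval (μ := fun s : PooledIndex n => (P s.1 : Measure 𝒳))
          (hgL s).aestronglyMeasurable]
        exact integral_const_mul _ _
      · intro s _
        exact ((hgL s).comp_measurePreserving (measurePreserving_eval _ s)).integrable
          (by norm_num)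
    have hk : (n k : ℝ) ≠ 0 := by exact_mod_cast (hn k).ne'
    have hl : (n l : ℝ) ≠ 0 := by exact_mod_cast (hn l).ne'
    rw [h1, sum_contrast_mul n k l fun s => ∫ x, e x ∂(P s.1 : Measure 𝒳)]
    have hk' := (isMeanEmbedding_meanEmbedding H hm (fun x y => (hB x y).2)
      (P k : Measure 𝒳) e).2
    have hl' := (isMeanEmbedding_meanEmbedding H hm (fun x y => (hB x y).2)
      (P l : Measure 𝒳) e).2
    rw [← hue, hu, inner_sub_left, hk', hl']
    simp [hk, hl]
  have hvar : Var[Y; μ] ≤ 2 * B / nMin n := by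
    rw [hY, hμ, variance_sum_pi hgL]
    have h1 : ∀ s : PooledIndex n,
        Var[g s; (P s.1 : Measure 𝒳)] ≤ contrast n k l s ^ 2 * B := by
      intro s
      rw [hg, variance_const_mul]
      refine mul_le_mul_of_nonneg_left ?_ (sq_nonneg _)
      have := variance_le_sq_of_bounded (μ := (P s.1 : Measure 𝒳)) (X := fun x => e x)
        (a := -√B) (b := √B) (Eventually.of_forall fun x => abs_le.1 (heB x)) hem.aemeasurable
      refine this.trans (le_of_eq ?_)
      rw [show (√B - -√B) / 2 = √B by ring, Real.sq_sqrt hB0.le]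
    refine (Finset.sum_le_sum fun s _ => h1 s).trans ?_
    rw [← Finset.sum_mul, sum_contrast_sq hn hkl.ne]
    have hmin' : (0 : ℝ) < nMin n := by exact_mod_cast hmin
    have hk := inv_anti₀ hmin' (Nat.cast_le (α := ℝ).2 (nMin_le n k))
    have hl := inv_anti₀ hmin' (Nat.cast_le (α := ℝ).2 (nMin_le n l))
    rw [div_eq_mul_inv]
    nlinarith
  calc μ {Z | statMax H n Z < t} ≤ μ {Z | t ≤ |Y Z - ∫ Z, Y Z ∂μ|} := by
        refine measure_mono fun Z hZ => ?_
        simp only [Set.mem_ofPred_eq] at hZ ⊢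
        rw [hmean, abs_sub_comm]
        refine le_trans ?_ (le_abs_self _)
        have h1 : Y Z ≤ ‖empMean H n k Z - empMean H n l Z‖ := by
          rw [hYval]
          refine (real_inner_le_norm _ _).trans ?_
          rw [he1, mul_one]
        have h2 := norm_empMean_sub_le_statMax H n Z hkl
        linarith
    _ ≤ ENNReal.ofReal (Var[Y; μ] / t ^ 2) := meas_ge_le_variance_div_sq hYL ht
    _ ≤ _ := by
        refine ENNReal.ofReal_le_ofReal ?_
        rw [← div_div]
        gcongr

end Data

/-! ### The type II error of the Monte-Carlo test -/

section TypeII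

variable {𝒳 : Type*} {H : Type*} [NormedAddCommGroup H] [InnerProductSpace ℝ H] [CompleteSpace H]
  [RKHS ℝ H 𝒳 ℝ]

open scoped Classical in
/-- If the test accepts although the observed statistic is at least `t`, then at least
`α (M + 1) - 1` of the permuted statistics are at least `t`. -/
theorem le_sum_of_testMC_eq_zero {K : ℕ} {n : Fin K → ℕ} {M : ℕ} {α t : ℝ}
    {Z : PooledIndex n → 𝒳} {b : Fin M → Equiv.Perm (PooledIndex n)}
    (h : testMC H n M α Z b = 0) (ht : t ≤ statMax H n Z) :
    α * (M + 1) - 1 ≤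
      ∑ i : Fin M, if t ≤ statMax H n (fun s => Z (b i s)) then (1 : ℝ) else 0 := by
  have h1 : α < pMC H n M Z b := by
    by_contra hcon
    rw [testMC, if_pos (not_lt.1 hcon)] at h
    exact one_ne_zero h
  rw [pMC, one_div, inv_mul_eq_div, lt_div_iff₀ (by positivity)] at h1
  have h2 : ∑ i : Fin M,
        (if statMax H n Z ≤ statMax H n (fun s => Z (b i s)) then (1 : ℝ) else 0) ≤
      ∑ i : Fin M, if t ≤ statMax H n (fun s => Z (b i s)) then (1 : ℝ) else 0 := by
    refine Finset.sum_le_sum fun i _ => ?_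
    by_cases hi : statMax H n Z ≤ statMax H n (fun s => Z (b i s))
    · rw [if_pos hi, if_pos (ht.trans hi)]
    · rw [if_neg hi]
      split_ifs <;> norm_num
  linarith

instance isProbabilityMeasure_uniformOn_perm {K : ℕ} (n : Fin K → ℕ) :
    IsProbabilityMeasure (uniformOn (Set.univ : Set (Equiv.Perm (PooledIndex n)))) :=
  isProbabilityMeasure_uniformOn Set.finite_univ Set.univ_nonempty

instance measurableSingletonClass_perm {K : ℕ} (n : Fin K → ℕ) :
    MeasurableSingletonClass (Equiv.Perm (PooledIndex n)) := ⟨fun _ => trivial⟩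

variable [MeasurableSpace 𝒳]

theorem typeIIErrorMC_le (hm : Measurable fun p : 𝒳 × 𝒳 => rkernel H p.1 p.2)
    {B : ℝ} (hB : ∀ x y : 𝒳, 0 ≤ rkernel H x y ∧ rkernel H x y ≤ B) (hB0 : 0 < B)
    {K : ℕ} (hK : 2 ≤ K) {n : Fin K → ℕ} (hn : ∀ k, 0 < n k) (hmin : 0 < nMin n)
    {P : Fin K → ProbabilityMeasure 𝒳} {t : ℝ} (ht : 0 < t)
    (hP : P ∈ sparseAlternatives (𝒳 := 𝒳) H K (2 * t))
    {M : ℕ} {α : ℝ} (hM : 0 < α * (M + 1) - 1) :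
    typeIIErrorMC H n M α P ≤ ENNReal.ofReal (2 * B / (nMin n * t ^ 2) +
      M * (2 * K ^ 2 * Real.exp (-(nMin n * t ^ 2 / (4 * B)))) / (α * (M + 1) - 1)) := by
  classical
  set κ := α * (M + 1) - 1 with hκ
  set η := 2 * (K : ℝ) ^ 2 * Real.exp (-(nMin n * t ^ 2 / (4 * B))) with hη
  set μ := Measure.pi fun s : PooledIndex n => (P s.1 : Measure 𝒳) with hμ
  set U := uniformOn (Set.univ : Set (Equiv.Perm (PooledIndex n))) with hU
  set ν := Measure.pi fun _ : Fin M => U with hν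
  set f : (PooledIndex n → 𝒳) × (Fin M → Equiv.Perm (PooledIndex n)) → ℝ≥0∞ := fun ω =>
    ∑ i : Fin M, if t ≤ statMax H n (fun s => ω.1 (ω.2 i s)) then 1 else 0 with hf
  have hfm : Measurable f := by
    refine measurable_from_prod_countable_left fun b => ?_
    refine Finset.measurable_fun_sum _ fun i _ => ?_
    refine Measurable.ite (measurableSet_le measurable_const ?_) measurable_const measurable_const
    exact (measurable_statMax hm n).comp
      (measurable_pi_lambda _ fun s => measurable_pi_apply (b i s))
  have hsub : {ω : (PooledIndex n → 𝒳) × (Fin M → Equiv.Perm (PooledIndex n)) |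
        testMC H n M α ω.1 ω.2 = 0} ⊆
      {Z | statMax H n Z < t} ×ˢ Set.univ ∪ {ω | ENNReal.ofReal κ ≤ f ω} := by
    intro ω hω
    rcases lt_or_ge (statMax H n ω.1) t with h | h
    · exact Or.inl ⟨h, Set.mem_univ _⟩
    · refine Or.inr ?_
      have := ENNReal.ofReal_le_ofReal (le_sum_of_testMC_eq_zero hω h)
      refine this.trans (le_of_eq ?_)
      rw [ENNReal.ofReal_sum_of_nonneg fun i _ => by split_ifs <;> norm_num]
      refine Finset.sum_congr rfl fun i _ => ?_
      split_ifs <;> simp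
  have hint : ∫⁻ ω, f ω ∂(μ.prod ν) ≤ ENNReal.ofReal (M * η) := by
    rw [lintegral_prod _ hfm.aemeasurable]
    have hin : ∀ Z, ∫⁻ b, f (Z, b) ∂ν ≤ ENNReal.ofReal (M * η) := by
      intro Z
      simp only [hf]
      rw [lintegral_finsetSum _ fun i _ => measurable_of_countable _]
      have hi : ∀ i : Fin M, ∫⁻ b : Fin M → Equiv.Perm (PooledIndex n),
          (if t ≤ statMax H n (fun s => Z (b i s)) then (1 : ℝ≥0∞) else 0) ∂ν ≤
          ENNReal.ofReal η := by
        intro i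
        have h1 := (measurePreserving_eval (fun _ : Fin M => U) i).lintegral_comp
          (f := fun c : Equiv.Perm (PooledIndex n) =>
            if t ≤ statMax H n (fun s => Z (c s)) then (1 : ℝ≥0∞) else 0)
          (measurable_of_countable _)
        have h2 : ∫⁻ c : Equiv.Perm (PooledIndex n),
            (if t ≤ statMax H n (fun s => Z (c s)) then (1 : ℝ≥0∞) else 0) ∂U =
            U {c | t ≤ statMax H n (fun s => Z (c s))} :=
          lintegral_indicator_one (μ := U)
            (s := {c : Equiv.Perm (PooledIndex n) | t ≤ statMax H n (fun s => Z (c s))}) trivial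
        exact (h1.trans h2).trans_le (uniformOn_perm_le_statMax_le hB0 hB hK hn Z ht.le)
      refine (Finset.sum_le_sum fun i _ => hi i).trans (le_of_eq ?_)
      rw [Finset.sum_const, Finset.card_univ, Fintype.card_fin, nsmul_eq_mul,
        ENNReal.ofReal_mul (Nat.cast_nonneg M), ENNReal.ofReal_natCast]
    refine (lintegral_mono hin).trans (le_of_eq ?_)
    rw [lintegral_const, measure_univ, mul_one]
  have htail : (μ.prod ν) {ω | ENNReal.ofReal κ ≤ f ω} ≤ ENNReal.ofReal (M * η / κ) := by
    rw [ENNReal.ofReal_div_of_pos hM]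
    refine (ENNReal.le_div_iff_mul_le (Or.inl (ENNReal.ofReal_pos.2 hM).ne')
      (Or.inl ENNReal.ofReal_ne_top)).2 ?_
    rw [mul_comm]
    exact (mul_meas_ge_le_lintegral hfm _).trans hint
  calc typeIIErrorMC H n M α P
      ≤ (μ.prod ν) ({Z | statMax H n Z < t} ×ˢ Set.univ) +
          (μ.prod ν) {ω | ENNReal.ofReal κ ≤ f ω} :=
        (measure_mono hsub).trans (measure_union_le _ _)
    _ ≤ ENNReal.ofReal (2 * B / (nMin n * t ^ 2)) + ENNReal.ofReal (M * η / κ) := by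
        refine add_le_add ?_ htail
        rw [Measure.prod_prod, measure_univ, mul_one]
        exact pi_statMax_lt_le hm hB hB0 hK hn hmin ht hP
    _ = _ := (ENNReal.ofReal_add (by positivity) (by positivity)).symm

/-- At separation `2 t = β r_N^⋆` the bound on the type II error is uniform in the design: `log K`
is at least `log 2`, and for large `β` the factor `K²` of the union bound is absorbed by
`exp (-β² log K / (16 B))`. -/
theorem typeIIErrorMC_le_of_rStar (hm : Measurable fun p : 𝒳 × 𝒳 => rkernel H p.1 p.2)
    {B : ℝ} (hB : ∀ x y : 𝒳, 0 ≤ rkernel H x y ∧ rkernel H x y ≤ B) (hB0 : 0 < B)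
    {K : ℕ} (hK : 2 ≤ K) {n : Fin K → ℕ} (hn : ∀ k, 0 < n k) (hmin : 0 < nMin n)
    {β : ℝ} (hβ : 0 < β) (hβB : 2 ≤ β ^ 2 / (16 * B))
    {P : Fin K → ProbabilityMeasure 𝒳}
    (hP : P ∈ sparseAlternatives (𝒳 := 𝒳) H K (β * rStar n))
    {M : ℕ} {α : ℝ} (hM : 0 < α * (M + 1) - 1) :
    typeIIErrorMC H n M α P ≤ ENNReal.ofReal (8 * B / (Real.log 2 * β ^ 2) +
      M * (2 * Real.exp (-((β ^ 2 / (16 * B) - 2) * Real.log 2))) / (α * (M + 1) - 1)) := by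
  have hmin' : (0 : ℝ) < nMin n := by exact_mod_cast hmin
  have hK' : (2 : ℝ) ≤ K := by exact_mod_cast hK
  have hlog2 : 0 < Real.log 2 := Real.log_pos one_lt_two
  have hlog : Real.log 2 ≤ Real.log K := Real.log_le_log two_pos hK'
  have hlogK : 0 < Real.log K := hlog2.trans_le hlog
  have hr : 0 < rStar n := Real.sqrt_pos.2 (by positivity)
  have hsq : nMin n * (β * rStar n / 2) ^ 2 = β ^ 2 * Real.log K / 4 := by
    rw [div_pow, mul_pow, rStar, Real.sq_sqrt (by positivity)]
    field_simp
    norm_num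
  have hP' : P ∈ sparseAlternatives (𝒳 := 𝒳) H K (2 * (β * rStar n / 2)) := by
    rwa [mul_div_cancel₀ _ (two_ne_zero)]
  refine (typeIIErrorMC_le hm hB hB0 hK hn hmin (by positivity) hP' hM).trans
    (ENNReal.ofReal_le_ofReal ?_)
  rw [hsq]
  refine add_le_add ?_ ?_
  · rw [div_le_div_iff₀ (by positivity) (by positivity)]
    have := mul_le_mul_of_nonneg_left hlog (show 0 ≤ 2 * B * β ^ 2 by positivity)
    linarith
  · refine div_le_div_of_nonneg_right ?_ hM.le
    refine mul_le_mul_of_nonneg_left ?_ (Nat.cast_nonneg M)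
    rw [mul_assoc]
    refine mul_le_mul_of_nonneg_left ?_ two_pos.le
    have hKexp : (K : ℝ) ^ 2 = Real.exp (2 * Real.log K) := by
      rw [two_mul, Real.exp_add, Real.exp_log (by linarith), sq]
    rw [hKexp, ← Real.exp_add]
    refine Real.exp_le_exp.2 ?_
    have e : β ^ 2 * Real.log K / 4 / (4 * B) = β ^ 2 / (16 * B) * Real.log K := by
      field_simp
      norm_num
    rw [e]
    have := mul_le_mul_of_nonneg_left hlog (sub_nonneg.2 hβB)
    linarith

end TypeII

theorem tendsto_typeII_bound {B : ℝ} (hB0 : 0 < B) (M κ : ℝ) :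
    Tendsto (fun β : ℝ => ENNReal.ofReal (8 * B / (Real.log 2 * β ^ 2) +
      M * (2 * Real.exp (-((β ^ 2 / (16 * B) - 2) * Real.log 2))) / κ)) atTop (𝓝 0) := by
  have hlog2 : 0 < Real.log 2 := Real.log_pos one_lt_two
  have hsq : Tendsto (fun β : ℝ => β ^ 2) atTop atTop := tendsto_pow_atTop two_ne_zero
  have h1 : Tendsto (fun β : ℝ => 8 * B / (Real.log 2 * β ^ 2)) atTop (𝓝 0) :=
    tendsto_const_nhds.div_atTop (hsq.const_mul_atTop hlog2)
  have h2 : Tendsto (fun β : ℝ => (β ^ 2 / (16 * B) - 2) * Real.log 2) atTop atTop :=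
    (tendsto_atTop_add_const_right _ (-2)
      (hsq.atTop_div_const (by positivity : 0 < 16 * B))).atTop_mul_const hlog2
  have h3 := ((Real.tendsto_exp_neg_atTop_nhds_zero.comp h2).const_mul 2).const_mul M
  have h4 := ENNReal.tendsto_ofReal (h1.add (h3.div_const κ))
  simpa using h4

end KSampleMMD

open KSampleMMD in
/-- The designs (number of samples `K i`, sample sizes `n i`, signal strength `b i`) are indexed by
a type `ι` with a filter `l` along which `n_min → ∞`; for instance `ι = ℕ` and `l = atTop`. -/
theorem corollary1 {𝒳 : Type*} [MeasurableSpace 𝒳]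
    {H : Type*} [NormedAddCommGroup H] [InnerProductSpace ℝ H] [CompleteSpace H] [RKHS ℝ H 𝒳 ℝ]
    (hmeas : Measurable fun p : 𝒳 × 𝒳 => rkernel H p.1 p.2)
    (B : ℝ) (hB : ∀ x y : 𝒳, 0 ≤ rkernel H x y ∧ rkernel H x y ≤ B)
    (α : ℝ) (hα0 : 0 < α) (hα1 : α < 1)
    {ι : Type*} (l : Filter ι)
    (K : ι → ℕ) (hK : ∀ i, 2 ≤ K i)
    (n : ∀ i, Fin (K i) → ℕ) (hn : ∀ i k, 0 < n i k)
    (c : ℝ) (hbal : ∀ i, (nMax (n i) : ℝ) / (nMin (n i) : ℝ) ≤ c)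
    (hmin : Tendsto (fun i => nMin (n i)) l atTop)
    (b : ι → ℝ) (hb : Tendsto b l atTop) :
    Tendsto
      (fun M : ℕ =>
        limsup
          (fun i => ⨆ P ∈ sparseAlternatives (𝒳 := 𝒳) H (K i) (b i * rStar (n i)),
            typeIIErrorMC H (n i) M α P) l)
      atTop (𝓝 0) := by
  -- Enlarging the bound `B` makes it positive.
  set B' := max B 1 with hB'
  have hB0 : 0 < B' := lt_max_of_lt_right one_pos
  have hBB : ∀ x y : 𝒳, 0 ≤ rkernel H x y ∧ rkernel H x y ≤ B' := fun x y =>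
    ⟨(hB x y).1, (hB x y).2.trans (le_max_left _ _)⟩
  -- The inner limit is zero as soon as the smallest attainable p-value is below `α`.
  have hM : ∀ᶠ M : ℕ in atTop, 0 < α * ((M : ℝ) + 1) - 1 := by
    have : Tendsto (fun M : ℕ => α * ((M : ℝ) + 1)) atTop atTop :=
      (tendsto_atTop_add_const_right _ 1 tendsto_natCast_atTop_atTop).const_mul_atTop hα0
    filter_upwards [this.eventually_gt_atTop 1] with M h
    linarith
  refine tendsto_const_nhds.congr' ?_
  filter_upwards [hM] with M hM
  symm
  refine le_antisymm (le_of_forall_pos_le_add fun ε hε => ?_) bot_le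
  rw [zero_add]
  refine limsup_le_of_le (by isBoundedDefault) ?_
  have hβ2 : ∀ᶠ β : ℝ in atTop, 2 ≤ β ^ 2 / (16 * B') :=
    ((tendsto_pow_atTop two_ne_zero).atTop_div_const
      (by positivity : 0 < 16 * B')).eventually_ge_atTop 2
  have hε' := (tendsto_typeII_bound hB0 M (α * ((M : ℝ) + 1) - 1)).eventually_le_const hε
  filter_upwards [hmin.eventually_gt_atTop 0, hb.eventually_gt_atTop 0, hb.eventually hβ2,
    hb.eventually hε'] with i hi hbi hβi hεi
  refine iSup₂_le fun P hP => ?_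
  exact (typeIIErrorMC_le_of_rStar hmeas hBB hB0 (hK i) (hn i) hi hbi hβi hP hM).trans hεi
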